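/- Let $\Gamma$ be a group. Call a resolution $\cdots\to P_1\to P_0\xrightarrow{\varepsilon}\mathbb{Z}\to 0$ of the trivial $\mathbb{Z}\Gamma$-module $\mathbb{Z}$ by projective left $\mathbb{Z}\Gamma$-modules a projective resolution. The group $\Gamma$ is of type $\mathrm{FP}_n(\mathbb{Z})$ if there is a projective resolution with $P_i$ finitely generated for all $i\le n$; a projective resolution is $m$-admissible if $P_m$ and $P_{m+1}$ are finitely generated free $\mathbb{Z}\Gamma$-modules equipped with chosen finite bases. If $\Gamma$ is finitely generated and $\ell_\Gamma$ is the word length of a finite generating set, a free $\mathbb{Z}\Gamma$-module with finite basis $B$ carries the weighted norm $$\Bigl\|\sum_{\gamma\in\Gamma,\,b\in B}a_{\gamma b}\,\gamma b\Bigr\|^{\Gamma}=\sum_{\gamma,b}|a_{\gamma b}|\,(1+\ell_\Gamma(\gamma)).$$ For $n\ge 1$ and an $(n-1)$-admissible resolution $P_*$ the weighted integral filling function is $$\mathrm{FV}^{n,w}_{\mathbb{Z},\Gamma}\colon\mathbb{R}_{\ge0}\to\mathbb{R}_{\ge0}\cup\{\infty\},\qquad \mathrm{FV}^{n,w}_{\mathbb{Z},\Gamma}(l)=\sup_{\substack{c\in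 P_{n-1}\text{ a cycle}\\ \|c\|^{\Gamma}\le l}}\ \inf_{\substack{b\in P_n\\ \partial b=c}}\|b\|^{\Gamma},$$ where $c$ is a cycle if $\partial c=0$ (for $n=1$: if $\varepsilon(c)=0$). For functions $f,g$ on $\mathbb{R}_{\ge0}$ write $f\preccurlyeq g$ if there are constants $C,D>0$ with $f(v)\le C\,g(Cv+D)+Cv+D$ for all $v\ge0$, and $f\approx g$ if $f\preccurlyeq g$ and $g\preccurlyeq f$. **Theorem.** Let $n\ge1$ and let $G$ and $H$ be groups of type $\mathrm{FP}_n(\mathbb{Z})$ that are quasi-isometric (i.e. they are finitely generated and there is a quasi-isometry between them for the word metrics of some finite generating sets). Then, for every choice of finite generating sets and of $(n-1)$-admissible resolutions for $G$ and $H$, the weighted integral filling functions $\mathrm{FV}^{n,w}_{\mathbb{Z},G}$ and $\mathrm{FV}^{n,w}_{\mathbb{Z},H}$ take only finite values, and $$\mathrm{FV}^{n,w}_{\mathbb{Z},G}\approx\mathrm{FV}^{n,w}_{\mathbb{Z},H}.$$ -/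

import Mathlib

open scoped NNReal ENNReal

universe u v w w'

/-! ### Word metrics and quasi-isometries -/

/-- The word length of `g` with respect to `S`: the least length of a word in letters from
`S ∪ S⁻¹` that represents `g`. (It is used only for generating sets `S`.) -/
noncomputable def wordLength {G : Type u} [Group G] (S : Set G) (g : G) : ℕ :=
  sInf {k | ∃ l : List G, (∀ x ∈ l, x ∈ S ∨ x⁻¹ ∈ S) ∧ l.prod = g ∧ l.length = k}

/-- The word metric `d(g, h) = ℓ(g⁻¹ h)`. -/
noncomputable def wordDist {G : Type u} [Group G] (S : Set G) (g h : G) : ℕ :=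
  wordLength S (g⁻¹ * h)

/-- `f` is a quasi-isometry for the word metrics of `S` and `T`: a quasi-isometric embedding
with coarsely dense image. -/
def IsQuasiIsometry {G : Type u} [Group G] {H : Type v} [Group H] (S : Set G) (T : Set H)
    (f : G → H) : Prop :=
  ∃ K C : ℝ, 1 ≤ K ∧ 0 ≤ C ∧
    (∀ x y : G, K⁻¹ * (wordDist S x y : ℝ) - C ≤ (wordDist T (f x) (f y) : ℝ) ∧
      (wordDist T (f x) (f y) : ℝ) ≤ K * (wordDist S x y : ℝ) + C) ∧
    ∀ h : H, ∃ g : G, (wordDist T h (f g) : ℝ) ≤ C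

/-- Two groups are quasi-isometric if they are finitely generated and there is a quasi-isometry
between them for the word metrics of some finite generating sets. -/
def QuasiIsometricGroups (G : Type u) [Group G] (H : Type v) [Group H] : Prop :=
  ∃ (S : Finset G) (T : Finset H),
    Subgroup.closure (S : Set G) = ⊤ ∧ Subgroup.closure (T : Set H) = ⊤ ∧
      ∃ f : G → H, IsQuasiIsometry (S : Set G) (T : Set H) f

/-! ### Projective resolutions of the trivial module -/

/-- A resolution `⋯ → X 1 → X 0 → ℤ → 0` of the trivial `ℤ[G]`-module `ℤ` by projective
(left) `ℤ[G]`-modules. -/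
structure IntProjectiveResolution (G : Type u) [Group G] where
  /-- the chain modules -/
  X : ℕ → Type w
  [addCommGroup : ∀ i, AddCommGroup (X i)]
  [module : ∀ i, Module (MonoidAlgebra ℤ G) (X i)]
  projective : ∀ i, Module.Projective (MonoidAlgebra ℤ G) (X i)
  /-- the differentials -/
  d : ∀ i, X (i + 1) →ₗ[MonoidAlgebra ℤ G] X i
  /-- the augmentation -/
  ε : X 0 →ₗ[MonoidAlgebra ℤ G] (Representation.trivial ℤ G ℤ).asModule
  ε_surjective : Function.Surjective ε
  exact_zero : Function.Exact (d 0) ε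
  exact_succ : ∀ i, Function.Exact (d (i + 1)) (d i)

attribute [instance] IntProjectiveResolution.addCommGroup IntProjectiveResolution.module

/-- `G` is of type `FP_n(ℤ)`. -/
def IsOfTypeFP (n : ℕ) (G : Type u) [Group G] : Prop :=
  ∃ P : IntProjectiveResolution.{u, u} G, ∀ i ≤ n, Module.Finite (MonoidAlgebra ℤ G) (P.X i)

/-- An `n`-admissible resolution: a projective resolution of `ℤ` whose modules in degrees `n` and
`n + 1` are finitely generated free, equipped with a choice of (finite) bases. -/
structure AdmissibleResolution (n : ℕ) (G : Type u) [Group G] extends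
    IntProjectiveResolution.{u, w} G where
  /-- the rank in degree `n` -/
  rank : ℕ
  /-- the basis in degree `n` -/
  basis : Module.Basis (Fin rank) (MonoidAlgebra ℤ G) (X n)
  /-- the rank in degree `n + 1` -/
  rankSucc : ℕ
  /-- the basis in degree `n + 1` -/
  basisSucc : Module.Basis (Fin rankSucc) (MonoidAlgebra ℤ G) (X (n + 1))

/-- Cycles of the augmented complex: `c ∈ X 0` is a cycle if `ε c = 0`, and `c ∈ X (k + 1)` is a
cycle if `∂ c = 0`. -/
def IntProjectiveResolution.IsCycle {G : Type u} [Group G] (P : IntProjectiveResolution.{u, w} G) :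
    ∀ n : ℕ, P.X n → Prop
  | 0, c => P.ε c = 0
  | k + 1, c => P.d k c = 0

/-! ### Weighted norms and weighted filling functions -/

/-- The weighted norm on a free `ℤ[G]`-module with finite basis `b`:
`‖∑ a_{γ,i} γ b_i‖ = ∑ |a_{γ,i}| (1 + ℓ(γ))`. -/
noncomputable def weightedNorm {G : Type u} [Group G] (S : Set G) {r : ℕ} {M : Type w}
    [AddCommGroup M] [Module (MonoidAlgebra ℤ G) M]
    (b : Module.Basis (Fin r) (MonoidAlgebra ℤ G) M) (x : M) : ℝ≥0 :=
  ∑ i : Fin r, (b.repr x i).coeff.sum fun γ a => ‖a‖₊ * (1 + (wordLength S γ : ℝ≥0))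

/-- The weighted filling volume of `c`: the infimum of the weighted norms of all `b` with
`∂ b = c`. -/
noncomputable def weightedFillVolume {G : Type u} [Group G] (S : Set G) {n : ℕ}
    (P : AdmissibleResolution.{u, w} n G) (c : P.X n) : ℝ≥0∞ :=
  ⨅ (b : P.X (n + 1)) (_ : P.d n b = c), (weightedNorm S P.basisSucc b : ℝ≥0∞)

/-- The weighted integral filling function of an `n`-admissible resolution: the supremum of the
weighted filling volumes of the `n`-cycles of weighted norm at most `l`. As it fills `n`-cycles by
`(n + 1)`-chains, it is the function denoted `FV^{n+1,w}_{ℤ,G}`. -/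
noncomputable def weightedFV {G : Type u} [Group G] (S : Set G) {n : ℕ}
    (P : AdmissibleResolution.{u, w} n G) (l : ℝ≥0) : ℝ≥0∞ :=
  ⨆ (c : P.X n) (_ : P.IsCycle n c) (_ : weightedNorm S P.basis c ≤ l), weightedFillVolume S P c

/-- `f ≼ g`: there are constants `C, D > 0` with `f v ≤ C g(C v + D) + C v + D` for all `v ≥ 0`. -/
def FillingLE (f g : ℝ≥0 → ℝ≥0∞) : Prop :=
  ∃ C D : ℝ≥0, 0 < C ∧ 0 < D ∧
    ∀ v : ℝ≥0, f v ≤ (C : ℝ≥0∞) * g (C * v + D) + (C : ℝ≥0∞) * (v : ℝ≥0∞) + (D : ℝ≥0∞)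

/-- `f ≈ g`: both `f ≼ g` and `g ≼ f`. -/
def FillingEquiv (f g : ℝ≥0 → ℝ≥0∞) : Prop :=
  FillingLE f g ∧ FillingLE g f

/-! A quasi-isometry `f : G → H` is not equivariant, so it induces no map between resolutions of `G`
and `H`. It does act, as an additive chain map, on the homogeneous bar resolution, whose chains are
combinations of tuples. Each given resolution is therefore compared with the bar resolution of its
group by equivariant chain maps, and `f` and a coarse inverse `g` act in the middle.

The weights make these non-equivariant composites bounded. An additive map is bounded once its
values on translates `γ b_i` of the basis grow linearly in `1 + ℓ(γ)`
(`exists_weightedNorm_le_of_single_smul`). The image of `b_i` in the bar resolution involves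
finitely many tuples, and `f` carries their `γ`-translate into the `f γ`-translate of a fixed finite
set. Translating back by `f γ` costs a factor `1 + ℓ(f γ)`, which is linear in `1 + ℓ(γ)`
(`IsControlledOver.exists_weightedNorm_le`).

A cycle over `G` is thus pushed to `H`, filled there, and the filling pulled back. The result has
the wrong boundary, but the discrepancy is filled, at a cost linear in the norm of the cycle, by
three homotopies: one for each of the two comparisons with a bar resolution, and the prism operator
joining `g ∘ f` to the identity (`exists_transport`). The linear term in the relation `≼` absorbs
this cost.

Finiteness of the filling functions holds because balls for the weighted norm are finite sets. -/

namespace IntProjectiveResolution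

/-! ### Chain maps and homotopies between projective resolutions. -/

section Comparison

variable {G : Type u} [Group G]

lemma isCycle_d (P : IntProjectiveResolution.{u, w} G) (n : ℕ) (b : P.X (n + 1)) :
    P.IsCycle n (P.d n b) := by
  cases n with
  | zero => exact (P.exact_zero _).2 ⟨b, rfl⟩
  | succ k => exact (P.exact_succ k _).2 ⟨b, rfl⟩

lemma IsCycle.exists_d_eq {P : IntProjectiveResolution.{u, w} G} {n : ℕ} {c : P.X n}
    (hc : P.IsCycle n c) : ∃ b, P.d n b = c := by
  cases n with
  | zero => exact (P.exact_zero _).1 hc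
  | succ k => exact (P.exact_succ k _).1 hc

/-- A linear map from a projective module into the cycles lifts along the differential. -/
lemma exists_lift_of_isCycle (P : IntProjectiveResolution.{u, w} G) (n : ℕ) {M : Type w'}
    [AddCommGroup M] [Module (MonoidAlgebra ℤ G) M] [Module.Projective (MonoidAlgebra ℤ G) M]
    (f : M →ₗ[MonoidAlgebra ℤ G] P.X n) (hf : ∀ m, P.IsCycle n (f m)) :
    ∃ g : M →ₗ[MonoidAlgebra ℤ G] P.X (n + 1), ∀ m, P.d n (g m) = f m := by
  obtain ⟨g, hg⟩ := Module.projective_lifting_property (P.d n).rangeRestrict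
    (f.codRestrict (LinearMap.range (P.d n)) fun m => (hf m).exists_d_eq)
    (LinearMap.surjective_rangeRestrict _)
  exact ⟨g, fun m => congrArg Subtype.val (LinearMap.congr_fun hg m)⟩

/-- The comparison theorem: there is an augmentation preserving chain map between any two
projective resolutions. -/
theorem exists_chainMap (P : IntProjectiveResolution.{u, w} G)
    (Q : IntProjectiveResolution.{u, w'} G) :
    ∃ φ : ∀ n, P.X n →ₗ[MonoidAlgebra ℤ G] Q.X n, (∀ x, Q.ε (φ 0 x) = P.ε x) ∧
      ∀ n x, Q.d n (φ (n + 1) x) = φ n (P.d n x) := by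
  have := P.projective
  obtain ⟨φ₀, h₀⟩ := Module.projective_lifting_property Q.ε P.ε Q.ε_surjective
  have h₀' : ∀ x, Q.ε (φ₀ x) = P.ε x := fun x => LinearMap.congr_fun h₀ x
  -- Preservation of cycles is the invariant carried through the recursion: it is what makes the
  -- next lift possible.
  have step : ∀ n (φ : {φ : P.X n →ₗ[MonoidAlgebra ℤ G] Q.X n //
      ∀ c, P.IsCycle n c → Q.IsCycle n (φ c)}),
      ∃ ψ : {ψ : P.X (n + 1) →ₗ[MonoidAlgebra ℤ G] Q.X (n + 1) //
        ∀ c, P.IsCycle (n + 1) c → Q.IsCycle (n + 1) (ψ c)},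
        ∀ x, Q.d n (ψ.1 x) = φ.1 (P.d n x) := by
    rintro n ⟨φ, hφ⟩
    obtain ⟨ψ, hψ⟩ := Q.exists_lift_of_isCycle n (φ ∘ₗ P.d n) fun m => hφ _ (P.isCycle_d n m)
    refine ⟨⟨ψ, fun c hc => ?_⟩, hψ⟩
    change Q.d n (ψ c) = 0
    rw [hψ, LinearMap.comp_apply, show P.d n c = 0 from hc, map_zero]
  choose next hnext using step
  let φ : ∀ n, {φ : P.X n →ₗ[MonoidAlgebra ℤ G] Q.X n //
      ∀ c, P.IsCycle n c → Q.IsCycle n (φ c)} := fun n =>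
    Nat.rec ⟨φ₀, fun c hc => (h₀' c).trans hc⟩ (fun n ψ => next n ψ) n
  exact ⟨fun n => (φ n).1, h₀', fun n => hnext n (φ n)⟩

/-- A chain endomorphism of a projective resolution that preserves the augmentation is chain
homotopic to the identity; on cycles one half of the homotopy formula survives. -/
theorem exists_homotopy_id (P : IntProjectiveResolution.{u, w} G)
    (φ : ∀ n, P.X n →ₗ[MonoidAlgebra ℤ G] P.X n) (hε : ∀ x, P.ε (φ 0 x) = P.ε x)
    (hd : ∀ n x, P.d n (φ (n + 1) x) = φ n (P.d n x)) (n : ℕ) :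
    ∃ h : P.X n →ₗ[MonoidAlgebra ℤ G] P.X (n + 1),
      ∀ c, P.IsCycle n c → P.d n (h c) = φ n c - c := by
  have := P.projective
  induction n with
  | zero =>
    obtain ⟨h, hh⟩ := P.exists_lift_of_isCycle 0 (φ 0 - LinearMap.id) fun m => by
      change P.ε (φ 0 m - m) = 0
      rw [map_sub, hε, sub_self]
    exact ⟨h, fun c _ => hh c⟩
  | succ n ih =>
    obtain ⟨h, hh⟩ := ih
    -- The map `φ - id - h ∘ d` has values in cycles, because the formula for `h` applies to `d m`,
    -- itself a cycle. On cycles its last term vanishes.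
    obtain ⟨k, hk⟩ := P.exists_lift_of_isCycle (n + 1)
      (φ (n + 1) - LinearMap.id - h ∘ₗ P.d n) fun m => by
        change P.d n (φ (n + 1) m - m - h (P.d n m)) = 0
        rw [map_sub, map_sub, hd, hh _ (P.isCycle_d n m), sub_self]
    refine ⟨k, fun c hc => ?_⟩
    rw [hk]
    change φ (n + 1) c - c - h (P.d n c) = _
    rw [show P.d n c = 0 from hc, map_zero, sub_zero]

end Comparison

end IntProjectiveResolution

/-! ### The homogeneous bar resolution -/

/-- The free abelian group on the `m`-tuples of elements of `G`. -/
def TupleChains (G : Type u) (m : ℕ) : Type u := FreeAbelianGroup (Fin m → G)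

namespace TupleChains

noncomputable instance (G : Type u) (m : ℕ) : AddCommGroup (TupleChains G m) :=
  inferInstanceAs (AddCommGroup (FreeAbelianGroup (Fin m → G)))

variable {G : Type u} {H : Type v} {A : Type w} [AddCommGroup A] {m k : ℕ}

/-- The chain given by a single tuple. -/
def of (x : Fin m → G) : TupleChains G m := FreeAbelianGroup.of x

/-- The additive extension of a function on tuples. -/
noncomputable def lift (φ : (Fin m → G) → A) : TupleChains G m →+ A := FreeAbelianGroup.lift φ

@[simp]
lemma lift_of (φ : (Fin m → G) → A) (x : Fin m → G) : lift φ (of x) = φ x :=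
  FreeAbelianGroup.lift_apply_of φ x

lemma addHom_ext {φ ψ : TupleChains G m →+ A} (h : ∀ x, φ (of x) = ψ (of x)) : φ = ψ :=
  FreeAbelianGroup.lift_ext _ _ h

lemma induction {p : TupleChains G m → Prop} (zero : p 0) (of : ∀ x, p (of x))
    (neg : ∀ z, p z → p (-z)) (add : ∀ y z, p y → p z → p (y + z)) (z : TupleChains G m) : p z :=
  FreeAbelianGroup.induction_on z zero of (fun _ h => neg _ h) add

/-- The map induced on chains by a function. -/
noncomputable def map (f : G → H) : TupleChains G m →+ TupleChains H m :=
  lift fun x => of (f ∘ x)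

@[simp]
lemma map_of (f : G → H) (x : Fin m → G) : map f (of x) = of (f ∘ x) := lift_of _ _

lemma map_map {K : Type w} (f : G → H) (g : H → K) (z : TupleChains G m) :
    map g (map f z) = map (g ∘ f) z := by
  refine DFunLike.congr_fun (f := (map g).comp (map f)) (g := map (g ∘ f))
    (addHom_ext fun x => ?_) z
  simp [Function.comp_assoc]

/-- The cone operator with apex `v`. -/
noncomputable def cone (v : G) : TupleChains G m →+ TupleChains G (m + 1) :=
  lift fun x => of (Fin.cons v x)

@[simp]
lemma cone_of (v : G) (x : Fin m → G) : cone v (of x) = of (Fin.cons v x : Fin (m + 1) → G) :=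
  lift_of _ _

/-- The boundary operator of the standard simplicial chain complex, as an additive map. -/
noncomputable def boundary : TupleChains G (m + 1) →+ TupleChains G m :=
  lift fun x => ∑ i : Fin (m + 1), (-1 : ℤ) ^ (i : ℕ) • of (x ∘ i.succAbove)

lemma boundary_of (x : Fin (m + 1) → G) :
    boundary (of x) = ∑ i : Fin (m + 1), (-1 : ℤ) ^ (i : ℕ) • of (x ∘ i.succAbove) := lift_of _ _

lemma map_boundary (f : G → H) (z : TupleChains G (m + 1)) :
    map f (boundary z) = boundary (map f z) := by
  refine DFunLike.congr_fun (f := (map f).comp boundary) (g := boundary.comp (map f))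
    (addHom_ext fun x => ?_) z
  simp [boundary_of, Function.comp_assoc]

lemma boundary_cone_zero (v : G) (z : TupleChains G 0) : boundary (cone v z) = z := by
  refine DFunLike.congr_fun (f := boundary.comp (cone v)) (g := AddMonoidHom.id _)
    (addHom_ext fun x => ?_) z
  simp only [AddMonoidHom.comp_apply, cone_of, boundary_of, AddMonoidHom.id_apply]
  simp [Subsingleton.elim _ x]

/-- Deleting the apex returns the original tuple; deleting any other entry gives the cone over a
face, with the sign shifted by one. This contraction yields exactness of the bar resolution. -/
lemma boundary_cone (v : G) (z : TupleChains G (m + 1)) :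
    boundary (cone v z) = z - cone v (boundary z) := by
  refine DFunLike.congr_fun (f := boundary.comp (cone v))
    (g := AddMonoidHom.id _ - (cone v).comp boundary) (addHom_ext fun x => ?_) z
  simp only [AddMonoidHom.comp_apply, cone_of, boundary_of, AddMonoidHom.id_apply,
    AddMonoidHom.sub_apply, map_sum, map_zsmul]
  rw [Fin.sum_univ_succ, sub_eq_add_neg, ← Finset.sum_neg_distrib]
  congr 1
  refine Finset.sum_congr rfl fun i _ => ?_
  rw [Fin.val_succ, pow_succ, mul_neg_one, neg_smul]
  congr 3
  ext j
  refine Fin.cases ?_ (fun j => ?_) j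
  · simp
  · simp [Fin.succ_succAbove_succ]

/-- Every tuple is the cone over its tail with apex its first entry, so the cone formula reduces the
claim to lower degree. -/
lemma boundary_boundary (z : TupleChains G (m + 2)) : boundary (boundary z) = 0 := by
  induction m with
  | zero =>
    refine DFunLike.congr_fun (f := boundary.comp boundary) (g := 0) (addHom_ext fun x => ?_) z
    rw [← Fin.cons_self_tail x, ← cone_of, AddMonoidHom.comp_apply, boundary_cone, map_sub,
      boundary_cone_zero, sub_self, AddMonoidHom.zero_apply]
  | succ m ih =>
    refine DFunLike.congr_fun (f := boundary.comp boundary) (g := 0) (addHom_ext fun x => ?_) z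
    rw [← Fin.cons_self_tail x, ← cone_of, AddMonoidHom.comp_apply, boundary_cone, map_sub,
      boundary_cone, ih, map_zero, sub_zero, sub_self, AddMonoidHom.zero_apply]

/-- The chain homotopy from the identity to `map p`. -/
noncomputable def prism (p : G → G) : ∀ m, TupleChains G m →+ TupleChains G (m + 1)
  | 0 => 0
  -- The apex is an entry of the tuple itself, so all vertices stay among those of `x` and `p ∘ x`;
  -- a fixed apex would destroy this locality.
  | m + 1 => lift fun x => cone (x 0) (map p (of x) - of x - prism p m (boundary (of x)))

/-- By induction the chain being coned off is a cycle, so the boundary of its cone is the chain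
itself. The induction starts with the empty tuple, which every `p` fixes. -/
lemma boundary_prism (p : G → G) (m : ℕ) (z : TupleChains G (m + 1)) :
    boundary (prism p (m + 1) z) = map p z - z - prism p m (boundary z) := by
  induction m with
  | zero =>
    refine DFunLike.congr_fun (f := boundary.comp (prism p 1))
      (g := map p - AddMonoidHom.id _ - (prism p 0).comp boundary) (addHom_ext fun x => ?_) z
    have h : (map p : TupleChains G 0 →+ TupleChains G 0) = AddMonoidHom.id _ :=
      addHom_ext fun x => by simp [Subsingleton.elim (p ∘ x) x]
    simp only [AddMonoidHom.comp_apply, AddMonoidHom.sub_apply, AddMonoidHom.id_apply, prism,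
      lift_of]
    rw [boundary_cone, map_sub boundary, map_sub boundary, ← map_boundary, h]
    simp
  | succ m ih =>
    refine DFunLike.congr_fun (f := boundary.comp (prism p (m + 2)))
      (g := map p - AddMonoidHom.id _ - (prism p (m + 1)).comp boundary)
      (addHom_ext fun x => ?_) z
    simp only [AddMonoidHom.comp_apply, AddMonoidHom.sub_apply, AddMonoidHom.id_apply]
    rw [prism, lift_of, boundary_cone, map_sub boundary, map_sub boundary, ← map_boundary, ih,
      boundary_boundary, map_zero, sub_zero, sub_self, map_zero, sub_zero]

/-! ### Chains with controlled vertices and number of tuples. -/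

/-- `IsBounded V N z`: the chain `z` is a signed sum of at most `N` tuples with entries in `V`. -/
inductive IsBounded (V : Set G) : ℕ → TupleChains G m → Prop
  | zero (N : ℕ) : IsBounded V N 0
  | of (x : Fin m → G) (hx : ∀ i, x i ∈ V) : IsBounded V 1 (of x)
  | neg {N : ℕ} {z : TupleChains G m} (hz : IsBounded V N z) : IsBounded V N (-z)
  | add {N N' : ℕ} {z z' : TupleChains G m} (hz : IsBounded V N z) (hz' : IsBounded V N' z') :
      IsBounded V (N + N') (z + z')

namespace IsBounded

variable {V W : Set G} {N N' : ℕ} {z z' : TupleChains G m}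

lemma sub (hz : IsBounded V N z) (hz' : IsBounded V N' z') : IsBounded V (N + N') (z - z') :=
  sub_eq_add_neg z z' ▸ hz.add hz'.neg

lemma map_addHom {U : Set H} {M : ℕ} {F : TupleChains G m →+ TupleChains H k}
    (hF : ∀ x : Fin m → G, (∀ i, x i ∈ V) → IsBounded U M (F (TupleChains.of x)))
    (hz : IsBounded V N z) : IsBounded U (N * M) (F z) := by
  induction hz with
  | zero N => rw [map_zero]; exact zero _
  | of x hx => rw [one_mul]; exact hF x hx
  | neg _ ih => rw [map_neg]; exact ih.neg
  | add _ _ ih ih' => rw [map_add, add_mul]; exact ih.add ih'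

lemma mono_right (h : N ≤ N') (hz : IsBounded V N z) : IsBounded V N' z := by
  simpa [Nat.add_sub_cancel' h] using hz.add (zero (N' - N))

lemma mono (h : V ⊆ W) (hz : IsBounded V N z) : IsBounded W N z := by
  simpa using hz.map_addHom (F := AddMonoidHom.id _) (M := 1) fun x hx => of x fun i => h (hx i)

lemma cone {v : G} (hv : v ∈ V) (hz : IsBounded V N z) : IsBounded V N (cone v z) := by
  simpa using hz.map_addHom (F := TupleChains.cone v) (M := 1) fun x hx => by
    rw [cone_of]
    exact of _ (Fin.cases hv hx)

lemma map (f : G → H) (hz : IsBounded V N z) : IsBounded (f '' V) N (map f z) := by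
  simpa using hz.map_addHom (F := TupleChains.map f) (M := 1) fun x hx => by
    rw [map_of]
    exact of _ fun i => ⟨_, hx i, rfl⟩

lemma sum {ι : Type*} (s : Finset ι) {f : ι → TupleChains G m}
    (hf : ∀ i ∈ s, IsBounded V N (f i)) : IsBounded V (s.card * N) (∑ i ∈ s, f i) := by
  classical
  induction s using Finset.induction_on with
  | empty => simpa using zero _
  | insert a s ha ih =>
    rw [Finset.sum_insert ha, Finset.card_insert_of_notMem ha, add_mul, one_mul, add_comm _ N]
    exact (hf a (by simp)).add (ih fun i hi => hf i (by simp [hi]))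

lemma boundary {z : TupleChains G (m + 1)} (hz : IsBounded V N z) :
    IsBounded V (N * (m + 1)) (boundary z) := by
  refine hz.map_addHom fun x hx => ?_
  rw [boundary_of]
  have := sum (V := V) (N := 1) (Finset.univ : Finset (Fin (m + 1)))
    (f := fun i => (-1 : ℤ) ^ (i : ℕ) • TupleChains.of (x ∘ i.succAbove)) fun i _ => by
      rcases neg_one_pow_eq_or ℤ (i : ℕ) with h | h <;> rw [h]
      · rw [one_smul]; exact of _ fun j => hx _
      · rw [neg_one_smul]; exact (of _ fun j => hx _).neg
  simpa using this

end IsBounded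

lemma exists_isBounded (z : TupleChains G m) :
    ∃ (V : Set G) (N : ℕ), V.Finite ∧ IsBounded V N z := by
  induction z using induction with
  | zero => exact ⟨∅, 0, Set.finite_empty, .zero 0⟩
  | of x => exact ⟨Set.range x, 1, Set.finite_range x, .of x fun i => ⟨i, rfl⟩⟩
  | neg z h => obtain ⟨V, N, hV, h⟩ := h; exact ⟨V, N, hV, h.neg⟩
  | add y z hy hz =>
    obtain ⟨V, N, hV, hy⟩ := hy
    obtain ⟨W, M, hW, hz⟩ := hz
    exact ⟨V ∪ W, N + M, hV.union hW,
      (hy.mono Set.subset_union_left).add (hz.mono Set.subset_union_right)⟩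

lemma exists_isBounded_prism (p : G → G) (m : ℕ) :
    ∃ M : ℕ, ∀ (V : Set G) (N : ℕ) (z : TupleChains G m), IsBounded V N z →
      IsBounded (V ∪ p '' V) (N * M) (prism p m z) := by
  induction m with
  | zero => exact ⟨0, fun V N z _ => IsBounded.zero _⟩
  | succ m ih =>
    obtain ⟨M, hM⟩ := ih
    -- For one tuple: `map p x` and `x` contribute one tuple each, and the prism over the `m + 1`
    -- faces at most `(m + 1) * M`.
    refine ⟨1 + 1 + 1 * (m + 1) * M, fun V N z hz => hz.map_addHom fun x hx => ?_⟩
    rw [prism, lift_of]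
    have h := IsBounded.of x hx
    exact IsBounded.cone (Or.inl (hx 0)) ((((h.map p).mono Set.subset_union_right).sub
      (h.mono Set.subset_union_left)).sub (hM _ _ _ h.boundary))

/-! ### The diagonal group action, projectivity and exactness. -/

section Group

variable [Group G]

noncomputable instance : Module (MonoidAlgebra ℤ G) (TupleChains G m) :=
  Module.compHom (TupleChains G m) (MonoidAlgebra.lift ℤ (AddMonoid.End (TupleChains G m)) G
    { toFun := fun g => map (g * ·)
      map_one' := addHom_ext fun x => by
        simp [Function.comp_def]
        rfl
      map_mul' := fun g h => addHom_ext fun x => by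
        
        change map _ (of x) = map _ (map _ (of x))
        simp [Function.comp_def, mul_assoc] }).toRingHom

lemma single_smul (g : G) (z : TupleChains G m) :
    MonoidAlgebra.single g (1 : ℤ) • z = map (g * ·) z := by
  change MonoidAlgebra.lift ℤ (AddMonoid.End (TupleChains G m)) G _ (MonoidAlgebra.single g 1) z = _
  rw [MonoidAlgebra.lift_single, one_smul]
  rfl

/-- An additive map that commutes with the group elements is linear over the group ring. -/
def _root_.AddMonoidHom.toMonoidAlgebraLinearMap {M : Type w} {M' : Type w'} [AddCommGroup M]
    [AddCommGroup M'] [Module (MonoidAlgebra ℤ G) M] [Module (MonoidAlgebra ℤ G) M'] (f : M →+ M')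
    (hf : ∀ (g : G) x, f (MonoidAlgebra.single g (1 : ℤ) • x) =
      MonoidAlgebra.single g (1 : ℤ) • f x) : M →ₗ[MonoidAlgebra ℤ G] M' :=
  { f with
    map_smul' := fun r x => by
      change f (r • x) = r • f x
      induction r using MonoidAlgebra.induction_on with
      | of g => exact hf g x
      | add r s hr hs => rw [add_smul, add_smul, map_add, hr, hs]
      | smul a r hr => rw [smul_assoc, smul_assoc, map_zsmul, hr] }

/-- The linear extension of an equivariant function on tuples. -/
noncomputable def liftLinear {M : Type w} [AddCommGroup M] [Module (MonoidAlgebra ℤ G) M]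
    (φ : (Fin m → G) → M)
    (hφ : ∀ (g : G) x, φ ((g * ·) ∘ x) = MonoidAlgebra.single g (1 : ℤ) • φ x) :
    TupleChains G m →ₗ[MonoidAlgebra ℤ G] M :=
  (lift φ).toMonoidAlgebraLinearMap fun g z => by
    rw [single_smul]
    refine DFunLike.congr_fun (f := (lift φ).comp (map (g * ·)))
      (g := (DistribSMul.toAddMonoidHom M (MonoidAlgebra.single g (1 : ℤ))).comp (lift φ))
      (addHom_ext fun x => ?_) z
    simp [hφ]

@[simp]
lemma liftLinear_of {M : Type w} [AddCommGroup M] [Module (MonoidAlgebra ℤ G) M]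
    (φ : (Fin m → G) → M) (hφ) (x : Fin m → G) : liftLinear φ hφ (of x) = φ x := lift_of φ x

variable (G) in
/-- The boundary operator as a linear map over the group ring. -/
noncomputable def boundaryLinear (m : ℕ) :
    TupleChains G (m + 1) →ₗ[MonoidAlgebra ℤ G] TupleChains G m :=
  boundary.toMonoidAlgebraLinearMap fun g z => by
    rw [single_smul, single_smul, map_boundary]

variable (G) in
/-- The augmentation of the bar resolution. -/
noncomputable def augmentation :
    TupleChains G 1 →ₗ[MonoidAlgebra ℤ G] (Representation.trivial ℤ G ℤ).asModule :=
  liftLinear (fun _ => (Representation.trivial ℤ G ℤ).asModuleEquiv.symm 1) fun g x => by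
    simp
    rfl

lemma linearMap_ext {M : Type w} [AddCommGroup M] [Module (MonoidAlgebra ℤ G) M]
    {φ ψ : TupleChains G m →ₗ[MonoidAlgebra ℤ G] M} (h : ∀ x, φ (of x) = ψ (of x)) : φ = ψ :=
  LinearMap.toAddMonoidHom_injective (addHom_ext h)

/-- A set-theoretic section is made equivariant by translating each tuple to have first entry `1`,
applying the section there and translating back. -/
instance projective (m : ℕ) : Module.Projective (MonoidAlgebra ℤ G) (TupleChains G (m + 1)) := by
  refine Module.Projective.of_lifting_property'' fun f hf => ?_
  choose s hs using hf
  refine ⟨liftLinear (fun x => MonoidAlgebra.single (x 0) (1 : ℤ) •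
    s (of (((x 0)⁻¹ * ·) ∘ x))) fun g x => ?_, linearMap_ext fun x => ?_⟩
  · rw [← mul_smul, MonoidAlgebra.single_mul_single, one_mul]
    simp [Function.comp_def]
  · rw [LinearMap.comp_apply, liftLinear_of, map_smul, hs, single_smul, map_of]
    simp [Function.comp_def]

/-- The only `0`-tuple is the empty one, so the boundary in lowest degree factors through the
augmentation. -/
lemma boundary_eq_zero_of_augmentation {z : TupleChains G 1} (h : augmentation G z = 0) :
    boundary z = 0 := by
  have key : (boundary : TupleChains G 1 →+ TupleChains G 0) =
      ((zmultiplesHom (TupleChains G 0) (of Fin.elim0)).comp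
        (Representation.trivial ℤ G ℤ).asModuleEquiv.toAddMonoidHom).comp
          (augmentation G).toAddMonoidHom := addHom_ext fun x => by
    simp [boundary_of, augmentation, Subsingleton.elim _ (Fin.elim0 : Fin 0 → G)]
  rw [key, AddMonoidHom.comp_apply]
  rw [show (augmentation G).toAddMonoidHom z = 0 from h, map_zero]

variable (G) in
/-- The homogeneous bar resolution. -/
noncomputable def barResolution : IntProjectiveResolution.{u, u} G where
  X m := TupleChains G (m + 1)
  projective m := projective m
  d m := boundaryLinear G (m + 1)
  ε := augmentation G
  ε_surjective n := ⟨(Representation.trivial ℤ G ℤ).asModuleEquiv n • of fun _ => 1, by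
    rw [map_zsmul, augmentation, liftLinear_of, ← map_zsmul, smul_eq_mul, mul_one,
      LinearEquiv.symm_apply_apply]⟩
  exact_zero z := by
    refine ⟨fun h => ⟨cone 1 z, ?_⟩, ?_⟩
    · change boundary (cone 1 z) = z
      rw [boundary_cone, boundary_eq_zero_of_augmentation h, map_zero, sub_zero]
    · rintro ⟨y, rfl⟩
      refine LinearMap.congr_fun (f := augmentation G ∘ₗ boundaryLinear G 1) (g := 0)
        (linearMap_ext fun x => ?_) y
      change augmentation G (boundary (of x)) = 0
      simp [boundary_of, Fin.sum_univ_two, augmentation]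
  exact_succ m z := by
    refine ⟨fun h => ⟨cone 1 z, ?_⟩, ?_⟩
    · change boundary (cone 1 z) = z
      rw [boundary_cone, show boundary z = 0 from h, map_zero, sub_zero]
    · rintro ⟨y, rfl⟩
      exact boundary_boundary y

/-- Such a chain is the boundary of its cone, which treats degree zero and positive degrees
uniformly. -/
lemma isCycle_of_boundary_eq_zero {z : TupleChains G (m + 1)} (hz : boundary z = 0) :
    (barResolution G).IsCycle m z := by
  have h := (barResolution G).isCycle_d m (cone 1 z)
  rwa [show (barResolution G).d m (cone 1 z) = z by
    change boundary (cone 1 z) = z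
    rw [boundary_cone, hz, map_zero, sub_zero]] at h

end Group

end TupleChains

/-! ### Word lengths and controlled maps -/

section WordLength

variable {G : Type u} [Group G] {S : Set G}

lemma exists_list_prod_eq (hS : Subgroup.closure S = ⊤) (g : G) :
    ∃ l : List G, (∀ x ∈ l, x ∈ S ∨ x⁻¹ ∈ S) ∧ l.prod = g ∧ l.length = wordLength S g := by
  have h : {k | ∃ l : List G, (∀ x ∈ l, x ∈ S ∨ x⁻¹ ∈ S) ∧ l.prod = g ∧ l.length = k}.Nonempty := by
    obtain ⟨l, hl, hg⟩ := Submonoid.exists_list_of_mem_closure (s := S ∪ S⁻¹) (x := g) (by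
      rw [← Subgroup.closure_toSubmonoid, hS]
      trivial)
    exact ⟨_, l, hl, hg, rfl⟩
  exact Nat.sInf_mem h

lemma wordLength_le_of_prod_eq {g : G} {l : List G} (hl : ∀ x ∈ l, x ∈ S ∨ x⁻¹ ∈ S)
    (hg : l.prod = g) : wordLength S g ≤ l.length :=
  Nat.sInf_le ⟨l, hl, hg, rfl⟩

lemma wordLength_mul_le (hS : Subgroup.closure S = ⊤) (g h : G) :
    wordLength S (g * h) ≤ wordLength S g + wordLength S h := by
  obtain ⟨l, hl, rfl, hlen⟩ := exists_list_prod_eq hS g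
  obtain ⟨l', hl', rfl, hlen'⟩ := exists_list_prod_eq hS h
  rw [← hlen, ← hlen', ← List.length_append]
  refine wordLength_le_of_prod_eq (fun x hx => ?_) List.prod_append
  exact (List.mem_append.1 hx).elim (hl x) (hl' x)

lemma finite_wordLength_le (hS : Subgroup.closure S = ⊤) (hfin : S.Finite) (k : ℕ) :
    {g | wordLength S g ≤ k}.Finite := by
  have key : ∀ k, {g | ∃ l : List G, (∀ x ∈ l, x ∈ S ∨ x⁻¹ ∈ S) ∧ l.prod = g ∧
      l.length ≤ k}.Finite := fun k => by
    induction k with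
    | zero =>
      refine (Set.finite_singleton (1 : G)).subset ?_
      rintro _ ⟨l, -, rfl, hl⟩
      simp [List.length_eq_zero_iff.1 (Nat.le_zero.1 hl)]
    | succ k ih =>
      refine (((Set.finite_singleton (1 : G)).union ((hfin.union hfin.inv).mul ih))).subset ?_
      rintro _ ⟨_ | ⟨x, l⟩, hl, rfl, hlen⟩
      · simp
      · exact Or.inr ⟨x, hl x (by simp), l.prod,
          ⟨l, fun y hy => hl y (by simp [hy]), rfl, by simpa using hlen⟩, by simp⟩
  refine (key k).subset fun g hg => ?_
  obtain ⟨l, hl, h, hlen⟩ := exists_list_prod_eq hS g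
  exact ⟨l, hl, h, hlen.trans_le hg⟩

end WordLength

/-! ### Controlled maps and coarse inverses. -/

section Controlled

variable {G : Type u} [Group G] {H : Type v} [Group H]

/-- A map of groups is controlled if it sends pairs of points at bounded distance to pairs of
points at bounded distance. -/
def IsControlled (f : G → H) : Prop :=
  ∀ E : Set G, E.Finite → ∃ F : Set H, F.Finite ∧ ∀ x y, x⁻¹ * y ∈ E → (f x)⁻¹ * f y ∈ F

/-- A self-map of a group is close to the identity if it moves points a bounded distance. -/
def IsCloseToId (p : G → G) : Prop :=
  ∃ E : Set G, E.Finite ∧ ∀ x, x⁻¹ * p x ∈ E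

lemma isControlled_id : IsControlled (id : G → G) := fun E hE => ⟨E, hE, fun _ _ h => h⟩

/-- Along a shortest word for `g`, each letter moves the image under `f` by an element of one finite
set, hence by a bounded length. The summand `1` absorbs the length of `f 1`. -/
lemma IsControlled.exists_wordLength_le {f : G → H} (hf : IsControlled f) {S : Set G} {T : Set H}
    (hS : Subgroup.closure S = ⊤) (hfin : S.Finite) (hT : Subgroup.closure T = ⊤) :
    ∃ C : ℕ, ∀ g, 1 + wordLength T (f g) ≤ C * (1 + wordLength S g) := by
  obtain ⟨F, hF, hf⟩ := hf _ (hfin.union hfin.inv)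
  obtain ⟨M, hM⟩ := (hF.image (wordLength T)).bddAbove
  have key : ∀ l : List G, (∀ x ∈ l, x ∈ S ∨ x⁻¹ ∈ S) → ∀ g,
      wordLength T (f (g * l.prod)) ≤ wordLength T (f g) + M * l.length := by
    intro l
    induction l with
    | nil => simp
    | cons x l ih =>
      intro hl g
      have h₁ := ih (fun y hy => hl y (by simp [hy])) (g * x)
      have h₂ : wordLength T ((f g)⁻¹ * f (g * x)) ≤ M :=
        hM ⟨_, hf g (g * x) (by simpa using hl x (by simp)), rfl⟩
      have h₃ := wordLength_mul_le hT (f g) ((f g)⁻¹ * f (g * x))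
      rw [mul_inv_cancel_left] at h₃
      rw [List.prod_cons, ← mul_assoc, List.length_cons, mul_add, mul_one]
      lia
  refine ⟨1 + wordLength T (f 1) + M, fun g => ?_⟩
  obtain ⟨l, hl, hg, hlen⟩ := exists_list_prod_eq hS g
  have := key l hl 1
  rw [one_mul, hg, hlen] at this
  nlinarith

/-- The inverse sends each point to some `g` whose image is within `C` of it; the lower
quasi-isometry bound turns closeness of images into closeness in `G`, and balls are finite. The
conclusion no longer mentions generating sets. -/
lemma IsQuasiIsometry.exists_controlled_inverse {S : Set G} {T : Set H}
    (hS : Subgroup.closure S = ⊤) (hfinS : S.Finite) (hT : Subgroup.closure T = ⊤)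
    (hfinT : T.Finite) {f : G → H} (hf : IsQuasiIsometry S T f) :
    IsControlled f ∧ ∃ g : H → G, IsControlled g ∧ IsCloseToId (g ∘ f) ∧ IsCloseToId (f ∘ g) := by
  obtain ⟨K, C, hK, hC, hd, hsurj⟩ := hf
  choose g hg using hsurj
  have hK0 : 0 < K := one_pos.trans_le hK
  have hballS : ∀ r : ℝ, {a : G | (wordLength S a : ℝ) ≤ r}.Finite := fun r =>
    (finite_wordLength_le hS hfinS ⌊r⌋₊).subset fun a ha => Nat.le_floor ha
  have hballT : ∀ r : ℝ, {a : H | (wordLength T a : ℝ) ≤ r}.Finite := fun r =>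
    (finite_wordLength_le hT hfinT ⌊r⌋₊).subset fun a ha => Nat.le_floor ha
  have hlow : ∀ x y R, (wordDist T (f x) (f y) : ℝ) ≤ R →
      (wordLength S (x⁻¹ * y) : ℝ) ≤ K * (R + C) := fun x y R h => by
    have h₁ : K⁻¹ * (wordLength S (x⁻¹ * y) : ℝ) ≤ R + C := by
      have := (hd x y).1
      rw [wordDist] at this
      linarith
    rwa [inv_mul_le_iff₀ hK0] at h₁
  refine ⟨fun E hE => ?_, g, fun E hE => ?_, ?_, ?_⟩
  · obtain ⟨M, hM⟩ := (hE.image (wordLength S)).bddAbove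
    refine ⟨_, hballT (K * M + C), fun x y h => ?_⟩
    have h₁ : (wordDist S x y : ℝ) ≤ M := Nat.cast_le.2 (hM ⟨_, h, rfl⟩)
    exact (hd x y).2.trans (by gcongr)
  · obtain ⟨N, hN⟩ := (hE.image (wordLength T)).bddAbove
    -- Lengths of inverses of elements of the `C`-ball are bounded by finiteness, so symmetry of the
    -- word length is not needed.
    obtain ⟨N', hN'⟩ := ((hballT C).inv.image (wordLength T)).bddAbove
    refine ⟨_, hballS (K * ((N' + N + C) + C)), fun x y h => hlow _ _ _ ?_⟩
    have h₁ : wordLength T (x⁻¹ * y) ≤ N := hN ⟨_, h, rfl⟩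
    have h₂ : wordLength T ((x⁻¹ * f (g x))⁻¹) ≤ N' := hN' ⟨_, by
      rw [Set.mem_inv, inv_inv]
      exact hg x, rfl⟩
    have h₃ := wordLength_mul_le hT ((x⁻¹ * f (g x))⁻¹ * (x⁻¹ * y)) (y⁻¹ * f (g y))
    have h₄ := wordLength_mul_le hT ((x⁻¹ * f (g x))⁻¹) (x⁻¹ * y)
    have h₅ : (x⁻¹ * f (g x))⁻¹ * (x⁻¹ * y) * (y⁻¹ * f (g y)) = (f (g x))⁻¹ * f (g y) := by group
    rw [h₅] at h₃
    have h₆ : (wordLength T (y⁻¹ * f (g y)) : ℝ) ≤ C := hg y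
    have h₇ : (wordLength T ((f (g x))⁻¹ * f (g y)) : ℝ) ≤
        N' + N + wordLength T (y⁻¹ * f (g y)) := by
      exact_mod_cast h₃.trans (by gcongr; exact h₄.trans (by gcongr))
    exact h₇.trans (by gcongr)
  · exact ⟨_, hballS (K * (C + C)), fun x => hlow _ _ _ (hg (f x))⟩
  · exact ⟨_, hballT C, hg⟩

end Controlled

/-! ### Estimates for weighted norms -/

section CoeffNorm

variable {G : Type u} [Group G] {S : Set G}

/-- The weighted norm on the group ring. -/
noncomputable def coeffNorm (S : Set G) (r : MonoidAlgebra ℤ G) : ℝ≥0 :=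
  r.coeff.sum fun γ a => ‖a‖₊ * (1 + (wordLength S γ : ℝ≥0))

@[simp]
lemma coeffNorm_zero : coeffNorm S 0 = 0 := Finsupp.sum_zero_index

@[simp]
lemma coeffNorm_single (γ : G) (a : ℤ) :
    coeffNorm S (MonoidAlgebra.single γ a) = ‖a‖₊ * (1 + (wordLength S γ : ℝ≥0)) :=
  Finsupp.sum_single_index (by simp)

lemma coeffNorm_add_le (r s : MonoidAlgebra ℤ G) :
    coeffNorm S (r + s) ≤ coeffNorm S r + coeffNorm S s := by
  classical
  have h : ∀ t : MonoidAlgebra ℤ G, t.coeff.support ⊆ r.coeff.support ∪ s.coeff.support →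
      coeffNorm S t = ∑ γ ∈ r.coeff.support ∪ s.coeff.support,
        ‖t.coeff γ‖₊ * (1 + (wordLength S γ : ℝ≥0)) := fun t ht =>
    Finsupp.sum_of_support_subset _ ht _ (by simp)
  rw [h (r + s) Finsupp.support_add, h r Finset.subset_union_left, h s Finset.subset_union_right,
    ← Finset.sum_add_distrib]
  refine Finset.sum_le_sum fun γ _ => ?_
  rw [← add_mul]
  gcongr
  exact nnnorm_add_le _ _

lemma coeffNorm_zsmul (n : ℤ) (r : MonoidAlgebra ℤ G) :
    coeffNorm S (n • r) = ‖n‖₊ * coeffNorm S r := by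
  rw [coeffNorm, MonoidAlgebra.coeff_smul, Finsupp.sum_smul_index' (by simp), coeffNorm,
    Finsupp.mul_sum]
  simp [mul_assoc]

/-- The weight `1 + ℓ` is submultiplicative. -/
lemma coeffNorm_single_mul_le (hS : Subgroup.closure S = ⊤) (g : G) (r : MonoidAlgebra ℤ G) :
    coeffNorm S (MonoidAlgebra.single g 1 * r) ≤ (1 + wordLength S g) * coeffNorm S r := by
  conv_lhs => rw [← r.sum_coeff_single, Finsupp.sum, Finset.mul_sum]
  refine (Finset.le_sum_of_subadditive _ coeffNorm_zero.le coeffNorm_add_le _ _).trans ?_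
  rw [coeffNorm, Finsupp.mul_sum, Finsupp.sum]
  refine Finset.sum_le_sum fun γ _ => ?_
  rw [MonoidAlgebra.single_mul_single, one_mul, coeffNorm_single, mul_left_comm]
  gcongr
  have h : (wordLength S (g * γ) : ℝ≥0) ≤ wordLength S g + wordLength S γ := by
    exact_mod_cast wordLength_mul_le hS g γ
  calc (1 : ℝ≥0) + wordLength S (g * γ) ≤ 1 + (wordLength S g + wordLength S γ) := by gcongr
    _ ≤ 1 + (wordLength S g + wordLength S γ) + wordLength S g * wordLength S γ := le_self_add
    _ = _ := by ring

/-- The weight confines the support to a finite ball, and integrality leaves finitely many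
coefficients. -/
lemma finite_coeffNorm_le (hS : Subgroup.closure S = ⊤) (hfin : S.Finite) (l : ℝ≥0) :
    {r : MonoidAlgebra ℤ G | coeffNorm S r ≤ l}.Finite := by
  classical
  refine ((((finite_wordLength_le hS hfin ⌊l⌋₊).toFinset.finsupp
    fun _ => Finset.Icc (-⌊l⌋₊ : ℤ) ⌊l⌋₊).finite_toSet).preimage
      MonoidAlgebra.coeff_injective.injOn).subset fun r hr => ?_
  have hle : ∀ γ, ‖r.coeff γ‖₊ * (1 + (wordLength S γ : ℝ≥0)) ≤ l := fun γ => by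
    by_cases h : γ ∈ r.coeff.support
    · exact (Finset.single_le_sum (f := fun γ => ‖r.coeff γ‖₊ * (1 + (wordLength S γ : ℝ≥0)))
        (fun _ _ => zero_le) h).trans hr
    · simp [Finsupp.notMem_support_iff.1 h]
  have hcast : ∀ a : ℤ, ‖a‖₊ = (a.natAbs : ℝ≥0) := fun a => (NNReal.natCast_natAbs a).symm
  refine Finset.mem_finsupp_iff.2 ⟨fun γ hγ => ?_, fun γ _ => ?_⟩
  · have h₁ : (1 : ℝ≥0) ≤ ‖r.coeff γ‖₊ := by
      rw [hcast]
      exact_mod_cast Int.natAbs_pos.2 (Finsupp.mem_support_iff.1 hγ)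
    simp only [Set.Finite.mem_toFinset, Set.mem_ofPred_eq]
    refine Nat.le_floor (le_trans ?_ (hle γ))
    calc (wordLength S γ : ℝ≥0) ≤ 1 + wordLength S γ := le_add_self
      _ ≤ _ := le_mul_of_one_le_left zero_le h₁
  · have h₁ : (r.coeff γ).natAbs ≤ ⌊l⌋₊ := Nat.le_floor (by
      rw [← hcast]
      exact (le_mul_of_one_le_right zero_le le_self_add).trans (hle γ))
    rw [Finset.mem_Icc]
    lia

end CoeffNorm

/-! ### Norm bounds on based free modules. -/

section WeightedNorm

variable {G : Type u} [Group G] {S : Set G} {r : ℕ} {M : Type w} [AddCommGroup M]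
  [Module (MonoidAlgebra ℤ G) M] (b : Module.Basis (Fin r) (MonoidAlgebra ℤ G) M)

lemma weightedNorm_eq_sum (x : M) : weightedNorm S b x = ∑ i, coeffNorm S (b.repr x i) := rfl

lemma weightedNorm_add_le (x y : M) :
    weightedNorm S b (x + y) ≤ weightedNorm S b x + weightedNorm S b y := by
  simp only [weightedNorm_eq_sum, ← Finset.sum_add_distrib, map_add, Finsupp.add_apply]
  exact Finset.sum_le_sum fun i _ => coeffNorm_add_le _ _

lemma weightedNorm_zsmul (n : ℤ) (x : M) :
    weightedNorm S b (n • x) = ‖n‖₊ * weightedNorm S b x := by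
  simp only [weightedNorm_eq_sum, Finset.mul_sum, map_zsmul, ← coeffNorm_zsmul]
  rfl

@[simp]
lemma weightedNorm_zero : weightedNorm S b 0 = 0 := by
  simpa using weightedNorm_zsmul b (S := S) 0 0

@[simp]
lemma weightedNorm_neg (x : M) : weightedNorm S b (-x) = weightedNorm S b x := by
  simpa using weightedNorm_zsmul b (S := S) (-1) x

lemma weightedNorm_single_smul_le (hS : Subgroup.closure S = ⊤) (g : G) (x : M) :
    weightedNorm S b (MonoidAlgebra.single g (1 : ℤ) • x) ≤
      (1 + wordLength S g) * weightedNorm S b x := by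
  simp only [weightedNorm_eq_sum, Finset.mul_sum, map_smul]
  exact Finset.sum_le_sum fun i _ => coeffNorm_single_mul_le hS _ _

lemma finite_weightedNorm_le (hS : Subgroup.closure S = ⊤) (hfin : S.Finite) (l : ℝ≥0) :
    {x | weightedNorm S b x ≤ l}.Finite := by
  refine ((Set.Finite.pi' fun _ : Fin r => finite_coeffNorm_le hS hfin l).preimage
    (f := fun x => ⇑(b.repr x))
    (DFunLike.coe_injective.comp b.repr.injective).injOn).subset fun x hx i => ?_
  exact (Finset.single_le_sum (f := fun i => coeffNorm S (b.repr x i))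
    (fun _ _ => zero_le) (Finset.mem_univ i)).trans hx

/-- An additive map between based free modules is bounded for the weighted norms if it grows at
most linearly on the translates of the basis elements. -/
lemma exists_weightedNorm_le_of_single_smul {H : Type v} [Group H] {T : Set H} {r' : ℕ}
    {M' : Type w'} [AddCommGroup M'] [Module (MonoidAlgebra ℤ H) M']
    (b' : Module.Basis (Fin r') (MonoidAlgebra ℤ H) M') (f : M →+ M')
    (hf : ∀ i, ∃ C : ℝ≥0, ∀ g : G, weightedNorm T b' (f (MonoidAlgebra.single g (1 : ℤ) • b i)) ≤
      C * (1 + wordLength S g)) :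
    ∃ C : ℝ≥0, ∀ x, weightedNorm T b' (f x) ≤ C * weightedNorm S b x := by
  choose C hC using hf
  refine ⟨∑ i, C i, fun x => ?_⟩
  have key : ∀ i (a : MonoidAlgebra ℤ G),
      weightedNorm T b' (f (a • b i)) ≤ C i * coeffNorm S a := fun i a => by
    conv_lhs => rw [← a.sum_coeff_single, Finsupp.sum, Finset.sum_smul, map_sum]
    refine (Finset.le_sum_of_subadditive _ (weightedNorm_zero b').le (weightedNorm_add_le b')
      _ _).trans ?_
    rw [coeffNorm, Finsupp.mul_sum, Finsupp.sum]
    refine Finset.sum_le_sum fun γ _ => ?_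
    have h : MonoidAlgebra.single γ (a.coeff γ) • b i =
        a.coeff γ • MonoidAlgebra.single γ (1 : ℤ) • b i := by
      rw [← smul_assoc, MonoidAlgebra.smul_single, smul_eq_mul, mul_one]
    rw [h, map_zsmul, weightedNorm_zsmul, mul_left_comm]
    gcongr
    exact hC i γ
  conv_lhs => rw [← b.sum_repr x, map_sum]
  refine (Finset.le_sum_of_subadditive _ (weightedNorm_zero b').le (weightedNorm_add_le b')
    _ _).trans ?_
  rw [weightedNorm_eq_sum, Finset.mul_sum]
  refine Finset.sum_le_sum fun i _ => (key i _).trans ?_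
  gcongr
  exact Finset.single_le_sum (fun _ _ => zero_le) (Finset.mem_univ i)

end WeightedNorm

/-! ### Operators on tuple chains that induce bounded maps. -/

section TupleChains

open TupleChains
open scoped Pointwise

variable {G : Type u} [Group G] {H : Type v} [Group H] {S : Set G} {T : Set H}

/-- Only finitely many tuples have entries in `E`, so `ψ` is bounded on them by some `C`;
translating by `g` costs a factor `1 + ℓ(g)`. -/
lemma TupleChains.IsBounded.exists_weightedNorm_le {r m : ℕ} {M : Type w} [AddCommGroup M]
    [Module (MonoidAlgebra ℤ G) M] (b : Module.Basis (Fin r) (MonoidAlgebra ℤ G) M)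
    (ψ : TupleChains G m →ₗ[MonoidAlgebra ℤ G] M) (hS : Subgroup.closure S = ⊤) {E : Set G}
    (hE : E.Finite) :
    ∃ C : ℝ≥0, ∀ (g : G) (N : ℕ) (z : TupleChains G m), IsBounded ((g * ·) '' E) N z →
      weightedNorm S b (ψ z) ≤ N * (C * (1 + wordLength S g)) := by
  obtain ⟨C, hC⟩ := ((Set.Finite.pi' fun _ : Fin m => hE).image
    fun x => weightedNorm S b (ψ (TupleChains.of x))).bddAbove
  refine ⟨C, fun g N z hz => ?_⟩
  induction hz with
  | zero => simp
  | of x hx =>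
    choose y hy hxy using hx
    have h : TupleChains.of x = MonoidAlgebra.single g (1 : ℤ) • TupleChains.of y := by
      rw [single_smul, map_of]
      exact congrArg TupleChains.of (funext fun i => (hxy i).symm)
    rw [h, map_smul, Nat.cast_one, one_mul, mul_comm]
    refine (weightedNorm_single_smul_le b hS g _).trans ?_
    gcongr
    exact hC ⟨y, hy, rfl⟩
  | neg _ ih => rwa [map_neg, weightedNorm_neg]
  | add _ _ ih ih' =>
    rw [map_add, Nat.cast_add, add_mul]
    exact (weightedNorm_add_le _ _ _).trans (add_le_add ih ih')

/-- `F` is controlled over `f`: on chains in a translate by `g` of a bounded set, `F` takes values in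
the chains in the translate by `f g` of a bounded set, and the number of tuples grows linearly. -/
def IsControlledOver {m k : ℕ} (f : G → H) (F : TupleChains G m →+ TupleChains H k) : Prop :=
  ∀ V : Set G, V.Finite → ∃ (E : Set H) (A : ℕ), E.Finite ∧ ∀ (g : G) (N : ℕ) z,
    IsBounded ((g * ·) '' V) N z → IsBounded ((f g * ·) '' E) (N * A) (F z)

namespace IsControlledOver

variable {m k : ℕ}

lemma comp {K : Type w} [Group K] {l : ℕ} {f : G → H} {F : TupleChains G m →+ TupleChains H k}
    {f' : H → K} {F' : TupleChains H k →+ TupleChains K l} (hF' : IsControlledOver f' F')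
    (hF : IsControlledOver f F) : IsControlledOver (f' ∘ f) (F'.comp F) := fun V hV => by
  obtain ⟨E, A, hE, h⟩ := hF V hV
  obtain ⟨E', A', hE', h'⟩ := hF' E hE
  exact ⟨E', A * A', hE', fun g N z hz => mul_assoc N A A' ▸ h' _ _ _ (h g N z hz)⟩

lemma map {f : G → H} (hf : IsControlled f) :
    IsControlledOver f (map f : TupleChains G m →+ TupleChains H m) := fun V hV => by
  obtain ⟨E, hE, h⟩ := hf V hV
  refine ⟨E, 1, hE, fun g N z hz => ?_⟩
  rw [mul_one]
  refine (hz.map f).mono ?_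
  rintro _ ⟨_, ⟨v, hv, rfl⟩, rfl⟩
  exact ⟨_, h g (g * v) (by simpa using hv), by simp⟩

/-- New vertices have the form `p (g v) = g v κ` with `κ` in a fixed finite set, so they remain in a
`g`-translate of a finite set. -/
lemma prism {p : G → G} (hp : IsCloseToId p) (m : ℕ) :
    IsControlledOver id (prism p m) := fun V hV => by
  obtain ⟨K, hK, hp⟩ := hp
  obtain ⟨A, hA⟩ := exists_isBounded_prism p m
  refine ⟨V ∪ V * K, A, hV.union (hV.mul hK), fun g N z hz =>
    (hA _ N z hz).mono (Set.union_subset (Set.image_mono Set.subset_union_left) ?_)⟩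
  rintro _ ⟨_, ⟨v, hv, rfl⟩, rfl⟩
  exact ⟨v * ((g * v)⁻¹ * p (g * v)), Or.inr (Set.mul_mem_mul hv (hp _)), by
    simp only [id]
    group⟩

/-- Equivariance reduces to tuples with entries in `V` itself, of which there are finitely many. -/
lemma linearMap (F : TupleChains G m →ₗ[MonoidAlgebra ℤ G] TupleChains G k) :
    IsControlledOver id F.toAddMonoidHom := fun V hV => by
  choose W N hW hb using fun x => exists_isBounded (F (TupleChains.of x))
  have hX : {x : Fin m → G | ∀ i, x i ∈ V}.Finite := Set.Finite.pi' fun _ => hV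
  obtain ⟨A, hA⟩ := (hX.image N).bddAbove
  refine ⟨⋃ x ∈ {x : Fin m → G | ∀ i, x i ∈ V}, W x, A, hX.biUnion fun x _ => hW x,
    fun g M z hz => hz.map_addHom fun x hx => ?_⟩
  choose y hy hxy using hx
  have h : TupleChains.of x = MonoidAlgebra.single g (1 : ℤ) • TupleChains.of y := by
    rw [single_smul, map_of]
    exact congrArg TupleChains.of (funext fun i => (hxy i).symm)
  change IsBounded _ _ (F (TupleChains.of x))
  rw [h, map_smul, single_smul]
  exact (((hb y).mono
    (Set.subset_iUnion₂ (s := fun x (_ : x ∈ {x : Fin m → G | ∀ i, x i ∈ V}) => W x) y hy)).mono_right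
       (hA ⟨y, hy, rfl⟩)).map _

end IsControlledOver

lemma IsControlled.comp {K : Type w} [Group K] {f : G → H} {f' : H → K} (hf' : IsControlled f')
    (hf : IsControlled f) : IsControlled (f' ∘ f) := fun E hE => by
  obtain ⟨F, hF, h⟩ := hf E hE
  obtain ⟨F', hF', h'⟩ := hf' F hF
  exact ⟨F', hF', fun x y hxy => h' _ _ (h x y hxy)⟩

/-- A transformation of tuple chains over a controlled map induces bounded maps between based free
modules. -/
lemma IsControlledOver.exists_weightedNorm_le {r r' m k : ℕ} {M : Type w} {M' : Type w'}
    [AddCommGroup M] [Module (MonoidAlgebra ℤ G) M] [AddCommGroup M']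
    [Module (MonoidAlgebra ℤ H) M'] {f : G → H} {F : TupleChains G m →+ TupleChains H k}
    (hF : IsControlledOver f F) (hf : IsControlled f)
    (b : Module.Basis (Fin r) (MonoidAlgebra ℤ G) M)
    (b' : Module.Basis (Fin r') (MonoidAlgebra ℤ H) M')
    (hS : Subgroup.closure S = ⊤) (hfin : S.Finite) (hT : Subgroup.closure T = ⊤)
    (β : M →ₗ[MonoidAlgebra ℤ G] TupleChains G m)
    (ψ : TupleChains H k →ₗ[MonoidAlgebra ℤ H] M') :
    ∃ C : ℝ≥0, ∀ x, weightedNorm T b' (ψ (F (β x))) ≤ C * weightedNorm S b x := by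
  obtain ⟨L, hL⟩ := hf.exists_wordLength_le hS hfin hT
  refine exists_weightedNorm_le_of_single_smul b b'
    (ψ.toAddMonoidHom.comp (F.comp β.toAddMonoidHom)) fun i => ?_
  obtain ⟨V, N, hV, hβ⟩ := exists_isBounded (β (b i))
  obtain ⟨E, A, hE, hFE⟩ := hF V hV
  obtain ⟨C, hC⟩ := IsBounded.exists_weightedNorm_le b' ψ hT hE
  refine ⟨(N * A : ℕ) * (C * L), fun g => ?_⟩
  have h := hC (f g) _ _ (hFE g N _ (hβ.map (g * ·)))
  rw [← single_smul, ← map_smul] at h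
  refine h.trans ?_
  rw [mul_assoc, mul_assoc]
  gcongr
  exact_mod_cast hL g

lemma LinearMap.exists_weightedNorm_le {r r' : ℕ} {M : Type w} {M' : Type w'} [AddCommGroup M]
    [Module (MonoidAlgebra ℤ G) M] [AddCommGroup M'] [Module (MonoidAlgebra ℤ G) M']
    (b : Module.Basis (Fin r) (MonoidAlgebra ℤ G) M)
    (b' : Module.Basis (Fin r') (MonoidAlgebra ℤ G) M') (hS : Subgroup.closure S = ⊤)
    (f : M →ₗ[MonoidAlgebra ℤ G] M') :
    ∃ C : ℝ≥0, ∀ x, weightedNorm S b' (f x) ≤ C * weightedNorm S b x :=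
  exists_weightedNorm_le_of_single_smul b b' f.toAddMonoidHom fun i =>
    ⟨weightedNorm S b' (f (b i)), fun g => by
      change weightedNorm S b' (f (MonoidAlgebra.single g (1 : ℤ) • b i)) ≤ _
      rw [map_smul, mul_comm]
      exact weightedNorm_single_smul_le b' hS g _⟩

end TupleChains

/-! ### Quasi-isometry invariance of the weighted filling functions -/

section FillingFunction

variable {G : Type u} [Group G] {H : Type v} [Group H] {S : Set G} {T : Set H} {n : ℕ}

lemma weightedFillVolume_le (S : Set G) (P : AdmissibleResolution.{u, w} n G)
    (b : P.X (n + 1)) : weightedFillVolume S P (P.d n b) ≤ weightedNorm S P.basisSucc b :=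
  iInf₂_le (f := fun b (_ : P.d n b = _) => (weightedNorm S P.basisSucc b : ℝ≥0∞)) b rfl

/-- The supremum runs over finitely many cycles, and exactness provides each with a filling. -/
lemma weightedFV_lt_top (hS : Subgroup.closure S = ⊤) (hfin : S.Finite)
    (P : AdmissibleResolution.{u, w} n G) (l : ℝ≥0) : weightedFV S P l < ∞ := by
  have hB : {c : P.X n | P.IsCycle n c ∧ weightedNorm S P.basis c ≤ l}.Finite :=
    (finite_weightedNorm_le P.basis hS hfin l).subset fun c hc => hc.2
  refine lt_of_le_of_lt (b := ∑ c ∈ hB.toFinset, weightedFillVolume S P c) ?_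
    (ENNReal.sum_lt_top.2 fun c hc => ?_)
  · exact iSup_le fun c => iSup₂_le fun hc hl =>
      Finset.single_le_sum (f := weightedFillVolume S P) (fun _ _ => zero_le)
        (hB.mem_toFinset.2 ⟨hc, hl⟩)
  · obtain ⟨b, rfl⟩ := ((hB.mem_toFinset.1 hc).1).exists_d_eq
    exact (weightedFillVolume_le S P b).trans_lt ENNReal.coe_lt_top

open TupleChains in
/-- If `f : G → H` and `g : H → G` are controlled and `g ∘ f` is close to the identity, then
`n`-cycles over `G` are transported to `H`, and fillings are transported back, with linear
control on the weighted norms and a linear correction term. -/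
theorem exists_transport (P : AdmissibleResolution.{u, w} n G)
    (Q : AdmissibleResolution.{v, w'} n H)
    (hS : Subgroup.closure S = ⊤) (hfinS : S.Finite) (hT : Subgroup.closure T = ⊤)
    (hfinT : T.Finite) {f : G → H} {g : H → G} (hf : IsControlled f) (hg : IsControlled g)
    (hgf : IsCloseToId (g ∘ f)) :
    ∃ (C : ℝ≥0) (φ : P.X n → Q.X n) (ψ : Q.X (n + 1) → P.X (n + 1)) (h : P.X n → P.X (n + 1)),
      (∀ c, P.IsCycle n c → Q.IsCycle n (φ c) ∧
        ∀ b, Q.d n b = φ c → P.d n (ψ b - h c) = c) ∧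
      (∀ c, weightedNorm T Q.basis (φ c) ≤ C * weightedNorm S P.basis c) ∧
      (∀ b, weightedNorm S P.basisSucc (ψ b) ≤ C * weightedNorm T Q.basisSucc b) ∧
      ∀ c, weightedNorm S P.basisSucc (h c) ≤ C * weightedNorm S P.basis c := by
  obtain ⟨β, hβε, hβd⟩ : ∃ β : ∀ i, P.X i →ₗ[MonoidAlgebra ℤ G] TupleChains G (i + 1),
      (∀ x, augmentation G (β 0 x) = P.ε x) ∧ ∀ i x, boundary (β (i + 1) x) = β i (P.d i x) :=
    P.exists_chainMap (barResolution G)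
  obtain ⟨α, hαε, hαd⟩ : ∃ α : ∀ i, TupleChains G (i + 1) →ₗ[MonoidAlgebra ℤ G] P.X i,
      (∀ z, P.ε (α 0 z) = augmentation G z) ∧ ∀ i z, P.d i (α (i + 1) z) = α i (boundary z) :=
    (barResolution G).exists_chainMap P.toIntProjectiveResolution
  obtain ⟨β', hβ'ε, hβ'd⟩ : ∃ β : ∀ i, Q.X i →ₗ[MonoidAlgebra ℤ H] TupleChains H (i + 1),
      (∀ x, augmentation H (β 0 x) = Q.ε x) ∧ ∀ i x, boundary (β (i + 1) x) = β i (Q.d i x) :=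
    Q.exists_chainMap (barResolution H)
  obtain ⟨α', hα'ε, hα'd⟩ : ∃ α : ∀ i, TupleChains H (i + 1) →ₗ[MonoidAlgebra ℤ H] Q.X i,
      (∀ z, Q.ε (α 0 z) = augmentation H z) ∧ ∀ i z, Q.d i (α (i + 1) z) = α i (boundary z) :=
    (barResolution H).exists_chainMap Q.toIntProjectiveResolution
  obtain ⟨k, hk⟩ : ∃ k : TupleChains H (n + 1) →ₗ[MonoidAlgebra ℤ H] TupleChains H (n + 2),
      ∀ z, boundary z = 0 → boundary (k z) = β' n (α' n z) - z := by
    obtain ⟨k, hk⟩ := (barResolution H).exists_homotopy_id (fun i => β' i ∘ₗ α' i)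
      (fun z => (hβ'ε _).trans (hα'ε z))
      (fun i z => (hβ'd i _).trans (congrArg (β' i) (hα'd i z))) n
    exact ⟨k, fun z hz => hk z (isCycle_of_boundary_eq_zero hz)⟩
  obtain ⟨h₀, hh₀⟩ := P.exists_homotopy_id (fun i => α i ∘ₗ β i)
    (fun x => (hαε _).trans (hβε x)) (fun i x => (hαd i _).trans (congrArg (α i) (hβd i x))) n
  obtain ⟨C₁, hC₁⟩ := (IsControlledOver.map hf).exists_weightedNorm_le hf P.basis Q.basis
    hS hfinS hT (β n) (α' n)
  obtain ⟨C₂, hC₂⟩ := (IsControlledOver.map hg).exists_weightedNorm_le hg Q.basisSucc P.basisSucc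
    hT hfinT hS (β' (n + 1)) (α (n + 1))
  obtain ⟨C₃, hC₃⟩ := (((IsControlledOver.map hg).comp (IsControlledOver.linearMap k)).comp
    (IsControlledOver.map hf)).exists_weightedNorm_le (hg.comp hf) P.basis P.basisSucc
      hS hfinS hS (β n) (α (n + 1))
  obtain ⟨C₄, hC₄⟩ := (IsControlledOver.prism hgf (n + 1)).exists_weightedNorm_le isControlled_id
    P.basis P.basisSucc hS hfinS hS (β n) (α (n + 1))
  obtain ⟨C₅, hC₅⟩ := h₀.exists_weightedNorm_le P.basis P.basisSucc hS
  -- If `b` fills the image of `c`, then `ψ b` has boundary `α g_* β' α' f_* β c`. The three terms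
  -- of the correction have boundaries `α g_* (β' α' - 1) f_* β c`, `α ((g ∘ f)_* - 1) β c` and `α β
  -- c - c`; they telescope to the difference between this boundary and `c`.
  refine ⟨C₁ + C₂ + (C₃ + C₄ + C₅), fun c => α' n (map f (β n c)),
    fun b => α (n + 1) (map g (β' (n + 1) b)),
    fun c => α (n + 1) (map g (k (map f (β n c)))) + α (n + 1) (prism (g ∘ f) (n + 1) (β n c)) +
      h₀ c, fun c hc => ?_, fun c => (hC₁ c).trans ?_, fun b => (hC₂ b).trans ?_, fun c => ?_⟩
  -- Writing the cycle as a boundary avoids separating degree zero, where being a cycle refers to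
  -- the augmentation.
  · obtain ⟨a, rfl⟩ := hc.exists_d_eq
    have hz : boundary (β n (P.d n a)) = 0 := by rw [← hβd, boundary_boundary]
    refine ⟨?_, fun b hb => ?_⟩
    · dsimp only
      rw [← hβd, map_boundary, ← hα'd]
      exact Q.isCycle_d n _
    · have hfz : boundary (map f (β n (P.d n a))) = 0 := by rw [← map_boundary, hz, map_zero]
      rw [map_sub, map_add, map_add, hαd, hαd, hαd, hh₀ _ hc, ← map_boundary, ← map_boundary,
        hk _ hfz, boundary_prism, hz, hβ'd, hb, map_sub, map_zero, sub_zero, map_sub, map_sub,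
        map_map]
      simp only [LinearMap.comp_apply]
      abel
  · gcongr
    exact le_self_add.trans le_self_add
  · gcongr
    exact le_add_self.trans le_self_add
  · calc _ ≤ C₃ * weightedNorm S P.basis c + C₄ * weightedNorm S P.basis c +
          C₅ * weightedNorm S P.basis c :=
        (weightedNorm_add_le _ _ _).trans (add_le_add
          ((weightedNorm_add_le _ _ _).trans (add_le_add (hC₃ c) (hC₄ c))) (hC₅ c))
      _ = (C₃ + C₄ + C₅) * weightedNorm S P.basis c := by ring
      _ ≤ _ := by gcongr ?_ * _; exact le_add_self

/-- The weighted filling function does not grow when passing to a group of which the given group is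
a coarse retract. -/
theorem fillingLE_weightedFV (P : AdmissibleResolution.{u, w} n G)
    (Q : AdmissibleResolution.{v, w'} n H)
    (hS : Subgroup.closure S = ⊤) (hfinS : S.Finite) (hT : Subgroup.closure T = ⊤)
    (hfinT : T.Finite) {f : G → H} {g : H → G} (hf : IsControlled f) (hg : IsControlled g)
    (hgf : IsCloseToId (g ∘ f)) : FillingLE (weightedFV S P) (weightedFV T Q) := by
  obtain ⟨C, φ, ψ, h, hc, hφ, hψ, hh⟩ := exists_transport P Q hS hfinS hT hfinT hf hg hgf
  have key : ∀ (l : ℝ≥0) c, P.IsCycle n c → weightedNorm S P.basis c ≤ l →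
      weightedFillVolume S P c ≤
        (C + 1 : ℝ≥0) * weightedFillVolume T Q (φ c) + (C + 1 : ℝ≥0) * l := fun l c hcyc hl => by
    -- The constant is enlarged to `C + 1` since `C` may be zero, and a nonzero finite factor can be
    -- moved inside the infimum over fillings.
    have hC₀ : ((C + 1 : ℝ≥0) : ℝ≥0∞) ≠ 0 := by simp
    conv_rhs => unfold weightedFillVolume
    simp only [ENNReal.mul_iInf_of_ne hC₀ ENNReal.coe_ne_top,
      ENNReal.iInf_add]
    refine le_iInf fun b => le_iInf fun hb => ?_
    have h₁ := weightedFillVolume_le S P (ψ b - h c)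
    rw [(hc c hcyc).2 b hb] at h₁
    refine h₁.trans ?_
    norm_cast
    calc weightedNorm S P.basisSucc (ψ b - h c)
        ≤ weightedNorm S P.basisSucc (ψ b) + weightedNorm S P.basisSucc (h c) := by
          rw [sub_eq_add_neg, ← weightedNorm_neg P.basisSucc (h c)]
          exact weightedNorm_add_le _ _ _
      _ ≤ C * weightedNorm T Q.basisSucc b + C * l :=
          add_le_add (hψ b) ((hh c).trans (by gcongr))
      _ ≤ _ := by gcongr <;> exact le_self_add
  refine ⟨C + 1, 1, by positivity, one_pos, fun l => ?_⟩
  refine iSup_le fun c => iSup₂_le fun hcyc hl => (key l c hcyc hl).trans ?_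
  have h₁ : weightedFillVolume T Q (φ c) ≤ weightedFV T Q ((C + 1) * l + 1) :=
    le_iSup_of_le (φ c) (le_iSup₂_of_le (hc c hcyc).1 ((hφ c).trans (by
      calc C * weightedNorm S P.basis c ≤ (C + 1) * l := by gcongr; exact le_self_add
        _ ≤ _ := le_self_add)) le_rfl)
  refine le_trans ?_ le_self_add
  gcongr

end FillingFunction

theorem mainTheorem5 (n : ℕ) (G : Type u) [Group G] (H : Type v) [Group H]
    (hG : IsOfTypeFP (n + 1) G) (hH : IsOfTypeFP (n + 1) H) (hGH : QuasiIsometricGroups G H)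
    (S : Finset G) (hS : Subgroup.closure (S : Set G) = ⊤)
    (T : Finset H) (hT : Subgroup.closure (T : Set H) = ⊤)
    (P : AdmissibleResolution.{u, w} n G) (Q : AdmissibleResolution.{v, w'} n H) :
    (∀ l : ℝ≥0, weightedFV (S : Set G) P l < ∞) ∧
      (∀ l : ℝ≥0, weightedFV (T : Set H) Q l < ∞) ∧
      FillingEquiv (weightedFV (S : Set G) P) (weightedFV (T : Set H) Q) := by
  obtain ⟨S₀, T₀, hS₀, hT₀, f, hf⟩ := hGH
  -- Being controlled or close to the identity does not depend on generators, so `S₀` and `T₀`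
  -- disappear here and the estimates can use `S` and `T`.
  obtain ⟨hf, g, hg, hgf, hfg⟩ :=
    hf.exists_controlled_inverse hS₀ S₀.finite_toSet hT₀ T₀.finite_toSet
  exact ⟨weightedFV_lt_top hS S.finite_toSet P, weightedFV_lt_top hT T.finite_toSet Q,
    fillingLE_weightedFV P Q hS S.finite_toSet hT T.finite_toSet hf hg hgf,
    fillingLE_weightedFV Q P hT T.finite_toSet hS S.finite_toSet hg hf hfg⟩
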